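/- For real numbers $M_1,M_2\ge 0$ and $N_1,N_2>0$ let \[ S(M_1,N_1;M_2,N_2)=\bigl\{(A,B)\in\mathbb{Z}^2:\ M_1\le |A|\le M_1+N_1,\ M_2\le |B|\le M_2+N_2,\ y^2=x^3+Ax+B \text{ is an elliptic curve } E \text{ over } \mathbb{Q} \text{ with } E[3](\mathbb{Q})\ne\{0_E\}\bigr\}. \] There are absolute constants $C>0$ and $J_0>0$ such that for every real $J\ge J_0$ the following hold. (1) If $M_1=M_2=0$, $N_1=J^2$ and $N_2=J^3$, then $S$ is finite and $\#S\le C\,J^4$. (2) For all real $b,c$ with $0<b<2$ and $0<c<3$: if $M_1=J^2-J^b$, $N_1=J^b$, $M_2=J^3-J^c$ and $N_2=J^c$, then $S$ is finite and $\#S\le C\,J^{\,b+c-\min(b,c)/2}$. -/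

import Mathlib

/-- The short Weierstrass curve `y² = x³ + A x + B` over `ℚ`, for integers `A` and `B`. -/
def shortWeierstrass (A B : ℤ) : WeierstrassCurve ℚ where
  a₁ := 0
  a₂ := 0
  a₃ := 0
  a₄ := A
  a₆ := B

/-- The rational `3`-torsion subgroup `E[3](ℚ)` of a Weierstrass curve over `ℚ`, inside the group
of rational points. -/
def rationalThreeTorsion (E : WeierstrassCurve ℚ) : AddSubgroup E.toAffine.Point :=
  AddSubgroup.torsionBy E.toAffine.Point 3

/-- The set of pairs `(A, B)` of integers with `M₁ ≤ |A| ≤ M₁ + N₁` and `M₂ ≤ |B| ≤ M₂ + N₂` such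
that `y² = x³ + A x + B` is an elliptic curve with a non-trivial rational `3`-torsion point. -/
def threeTorsionBox (M₁ N₁ M₂ N₂ : ℝ) : Set (ℤ × ℤ) :=
  {p | (M₁ ≤ |(p.1 : ℝ)| ∧ |(p.1 : ℝ)| ≤ M₁ + N₁) ∧
    (M₂ ≤ |(p.2 : ℝ)| ∧ |(p.2 : ℝ)| ≤ M₂ + N₂) ∧
    (shortWeierstrass p.1 p.2).IsElliptic ∧
    rationalThreeTorsion (shortWeierstrass p.1 p.2) ≠ ⊥}

/-! If `x` is the abscissa of a rational 3-torsion point, then `w = 3x` is an integer root of a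
monic quartic in which `B` occurs only in the term `108 B w`. Fix `A ≠ 0`. Then `w ≠ 0` and `w`
determines `B`, so it suffices to count the possible `w`. On `w > 0`, `B` decreases as `w` grows, at
least as fast as a cube (`cube_sub_le_of_division_roots`), so `B` in a window of length `N₂` leaves
`O(N₂^(1/3))` values of `w`. Summing over `A` gives `O(N₁ N₂^(1/3))`, stronger than both claims. For
`A = 0` the root `w = 0` carries no information and all `O(N₂)` values of `B` are counted. -/

/-! ### Counting integers and fibres -/

/-- A set of integers of diameter at most `D` has at most `D + 1` elements. -/
theorem Int.finite_and_ncard_le_of_sub_le {S : Set ℤ} {D : ℝ} (hD : 0 ≤ D)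
    (h : ∀ u ∈ S, ∀ v ∈ S, (v : ℝ) - u ≤ D) : S.Finite ∧ (S.ncard : ℝ) ≤ D + 1 := by
  rcases S.eq_empty_or_nonempty with rfl | ⟨u₀, hu₀⟩
  · simp only [Set.finite_empty, Set.ncard_empty, Nat.cast_zero, true_and]
    linarith
  have hfin : S.Finite := by
    refine (Set.finite_Icc (u₀ - ⌊D⌋) (u₀ + ⌊D⌋)).subset fun v hv => ?_
    have h₁ : v - u₀ ≤ ⌊D⌋ := Int.le_floor.2 (by push_cast; exact h u₀ hu₀ v hv)
    have h₂ : u₀ - v ≤ ⌊D⌋ := Int.le_floor.2 (by push_cast; exact h v hv u₀ hu₀)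
    exact ⟨by linarith, by linarith⟩
  refine ⟨hfin, ?_⟩
  obtain ⟨m, hm, hmin⟩ := Set.exists_min_image S id hfin ⟨u₀, hu₀⟩
  have hsub : S ⊆ ((Finset.Icc m (m + ⌊D⌋) : Finset ℤ) : Set ℤ) := by
    intro v hv
    have h₁ : v - m ≤ ⌊D⌋ := Int.le_floor.2 (by push_cast; exact h m hm v hv)
    have h₂ : m ≤ v := hmin v hv
    simp only [Finset.coe_Icc, Set.mem_Icc]
    exact ⟨h₂, by linarith⟩
  have hcard := Set.ncard_le_ncard hsub (Finset.finite_toSet _)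
  rw [Set.ncard_coe_finset, Int.card_Icc] at hcard
  have hfl : (0 : ℤ) ≤ ⌊D⌋ := Int.floor_nonneg.2 hD
  have hz : (S.ncard : ℤ) ≤ ⌊D⌋ + 1 := by omega
  have hr : (S.ncard : ℝ) ≤ (⌊D⌋ : ℝ) + 1 := by exact_mod_cast hz
  linarith [Int.floor_le D]

/-- The integers `n` with `M ≤ |n| ≤ M + N` number at most `2 (N + 1)`. -/
theorem Int.finite_and_ncard_le_of_abs_window (M : ℝ) {N : ℝ} (hN : 0 ≤ N) :
    {n : ℤ | M ≤ |(n : ℝ)| ∧ |(n : ℝ)| ≤ M + N}.Finite ∧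
      ({n : ℤ | M ≤ |(n : ℝ)| ∧ |(n : ℝ)| ≤ M + N}.ncard : ℝ) ≤ 2 * (N + 1) := by
  obtain ⟨hf₁, hc₁⟩ := Int.finite_and_ncard_le_of_sub_le
    (S := {n : ℤ | M ≤ (n : ℝ) ∧ (n : ℝ) ≤ M + N}) hN
    (fun u hu v hv => by linarith [hu.1, hv.2])
  obtain ⟨hf₂, hc₂⟩ := Int.finite_and_ncard_le_of_sub_le
    (S := {n : ℤ | M ≤ -(n : ℝ) ∧ -(n : ℝ) ≤ M + N}) hN
    (fun u hu v hv => by linarith [hv.1, hu.2])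
  have hsub : {n : ℤ | M ≤ |(n : ℝ)| ∧ |(n : ℝ)| ≤ M + N} ⊆
      {n : ℤ | M ≤ (n : ℝ) ∧ (n : ℝ) ≤ M + N} ∪ {n : ℤ | M ≤ -(n : ℝ) ∧ -(n : ℝ) ≤ M + N} := by
    rintro n hn
    rcases abs_choice (n : ℝ) with h | h <;> simp only [Set.mem_ofPred_eq, h] at hn
    · exact Or.inl hn
    · exact Or.inr hn
  refine ⟨(hf₁.union hf₂).subset hsub, ?_⟩
  have h₁ := Set.ncard_le_ncard hsub (hf₁.union hf₂)
  have h₂ := h₁.trans (Set.ncard_union_le _ _)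
  have h₃ : ({n : ℤ | M ≤ |(n : ℝ)| ∧ |(n : ℝ)| ≤ M + N}.ncard : ℝ) ≤
      ({n : ℤ | M ≤ (n : ℝ) ∧ (n : ℝ) ≤ M + N}.ncard : ℝ) +
        ({n : ℤ | M ≤ -(n : ℝ) ∧ -(n : ℝ) ≤ M + N}.ncard : ℝ) := by exact_mod_cast h₂
  linarith

/-- If all fibres of the first projection have at most `K` elements, then the set has at most
`K` times as many elements as its projection. -/
theorem Set.finite_and_ncard_le_of_fst_fibers {α β : Type*} {S : Set (α × β)} {F : Set α}
    (hF : F.Finite) {K : ℝ} (hSF : ∀ p ∈ S, p.1 ∈ F)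
    (hK : ∀ a ∈ F, {b | (a, b) ∈ S}.Finite ∧ ({b | (a, b) ∈ S}.ncard : ℝ) ≤ K) :
    S.Finite ∧ (S.ncard : ℝ) ≤ F.ncard * K := by
  classical
  have hfin : S.Finite := by
    refine (hF.biUnion fun a ha => (hK a ha).1.image (Prod.mk a)).subset fun p hp => ?_
    exact Set.mem_biUnion (hSF p hp) ⟨p.2, hp, rfl⟩
  refine ⟨hfin, ?_⟩
  rw [Set.ncard_eq_toFinset_card S hfin, Set.ncard_eq_toFinset_card F hF,
    Finset.card_eq_sum_card_fiberwise (f := Prod.fst) (t := hF.toFinset)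
      (fun p hp => by simpa using hSF p (by simpa using hp)), Nat.cast_sum, ← nsmul_eq_mul]
  refine Finset.sum_le_card_nsmul _ _ _ fun a ha => ?_
  have haF : a ∈ F := by simpa using ha
  refine le_trans ?_ (hK a haF).2
  rw [Nat.cast_le, Set.ncard_eq_toFinset_card _ (hK a haF).1]
  refine Finset.card_le_card_of_injOn Prod.snd ?_ ?_
  · rintro ⟨a', b⟩ hp
    simp only [Finset.coe_filter, Set.Finite.mem_toFinset, Set.mem_ofPred_eq] at hp
    obtain ⟨hp, rfl⟩ := hp
    simpa using hp
  · rintro ⟨a₁, b₁⟩ h₁ ⟨a₂, b₂⟩ h₂ hb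
    simp only [Finset.coe_filter, Set.mem_ofPred_eq] at h₁ h₂
    exact Prod.ext (h₁.2.trans h₂.2.symm) hb

/-! ### From torsion points to integer roots -/

/-- The abscissa of a non-trivial rational `3`-torsion point is a root of the third division
polynomial. -/
theorem exists_root_of_rationalThreeTorsion_ne_bot {A B : ℤ}
    (h : rationalThreeTorsion (shortWeierstrass A B) ≠ ⊥) :
    ∃ x : ℚ, 3 * x ^ 4 + 6 * A * x ^ 2 + 12 * B * x = A ^ 2 := by
  obtain ⟨⟨P, hP⟩, hne⟩ := (AddSubgroup.ne_bot_iff_exists_ne_zero).1 h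
  have hP0 : P ≠ 0 := fun h0 => hne (Subtype.ext h0)
  have h3 : (3 : ℤ) • P = 0 := by simpa [rationalThreeTorsion] using hP
  have h2 : P + P = -P := by
    rw [eq_neg_iff_add_eq_zero, ← h3]; abel
  rcases P with _ | ⟨x, y, hns⟩
  · exact absurd rfl hP0
  refine ⟨x, ?_⟩
  have heq := (WeierstrassCurve.Affine.equation_iff _ _).1 hns.1
  by_cases hy : y = (shortWeierstrass A B).toAffine.negY x y
  · rw [WeierstrassCurve.Affine.Point.add_self_of_Y_eq hy] at h2
    exact absurd (neg_eq_zero.1 h2.symm) hP0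
  · rw [WeierstrassCurve.Affine.Point.add_self_of_Y_ne hy,
      WeierstrassCurve.Affine.Point.neg_some, WeierstrassCurve.Affine.Point.some.injEq] at h2
    have hx := h2.1
    rw [WeierstrassCurve.Affine.slope_of_Y_ne rfl hy] at hx
    simp only [WeierstrassCurve.Affine.addX, WeierstrassCurve.Affine.negY, shortWeierstrass,
      mul_zero, zero_mul, sub_zero, add_zero, sub_neg_eq_add] at hx hy heq
    have hy0 : y + y ≠ 0 := fun h0 => hy (eq_neg_of_add_eq_zero_left h0)
    -- Equal abscissas of `2P` and `-P`: the tangent slope squared, minus `2x`, is `x`.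
    have hs : ((3 * x ^ 2 + A) / (y + y)) ^ 2 = 3 * x := by linear_combination hx
    rw [div_pow, div_eq_iff (pow_ne_zero 2 hy0)] at hs
    linear_combination -hs - 12 * x * heq

/-- Three times the abscissa of a rational `3`-torsion point is an integer. -/
theorem exists_int_root_of_rationalThreeTorsion_ne_bot {A B : ℤ}
    (h : rationalThreeTorsion (shortWeierstrass A B) ≠ ⊥) :
    ∃ w : ℤ, w ^ 4 + 18 * A * w ^ 2 + 108 * B * w = 27 * A ^ 2 := by
  obtain ⟨x, hx⟩ := exists_root_of_rationalThreeTorsion_ne_bot h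
  have hw : (3 * x) ^ 4 + 18 * A * (3 * x) ^ 2 + 108 * B * (3 * x) = 27 * A ^ 2 := by
    linear_combination 27 * hx
  have hint : IsIntegral ℤ (3 * x) := by
    refine ⟨Polynomial.X ^ 4 + Polynomial.C (18 * A) * Polynomial.X ^ 2 +
      Polynomial.C (108 * B) * Polynomial.X + Polynomial.C (-27 * A ^ 2), by monicity!, ?_⟩
    simp only [Polynomial.eval₂_add, Polynomial.eval₂_mul, Polynomial.eval₂_pow,
      Polynomial.eval₂_X, Polynomial.eval₂_C]
    simp only [algebraMap_int_eq, eq_intCast]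
    push_cast
    linear_combination hw
  obtain ⟨w, hwx⟩ := IsIntegrallyClosed.isIntegral_iff.1 hint
  refine ⟨w, ?_⟩
  have hwx' : (w : ℚ) = 3 * x := by simpa using hwx
  rw [← hwx'] at hw
  exact_mod_cast hw

/-! ### Spacing of the roots for fixed `A` -/

/-- Two positive roots of division polynomials with the same `A` differ by at most the cube root
of a multiple of the difference of the constant coefficients. -/
theorem cube_sub_le_of_division_roots {A B B' w w' : ℝ} (hw' : 0 < w') (hle : w' ≤ w)
    (h : w ^ 4 + 18 * A * w ^ 2 + 108 * B * w = 27 * A ^ 2)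
    (h' : w' ^ 4 + 18 * A * w' ^ 2 + 108 * B' * w' = 27 * A ^ 2) :
    (w - w') ^ 3 ≤ 108 * (B' - B) := by
  have hw : 0 < w := hw'.trans_le hle
  -- Eliminating the `A ^ 2` terms leaves a quadratic form in `A` that is a perfect square, so the
  -- sign of `A` does not matter.
  have key : w * w' * (108 * (B' - B) - (w - w') ^ 3) = 3 * (w - w') * (3 * A + w * w') ^ 2 := by
    linear_combination w * h' - w' * h
  have hnn : 0 ≤ w * w' * (108 * (B' - B) - (w - w') ^ 3) := by
    rw [key]
    have := sub_nonneg.2 hle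
    positivity
  linarith [nonneg_of_mul_nonneg_right hnn (mul_pos hw hw')]

/-- For fixed `A`, a root `w > 0` determines `B`, so choosing one root per `B` is injective; the
cube bound confines the chosen roots to a short interval. -/
theorem finite_and_ncard_le_of_pos_root (A : ℤ) (M : ℝ) {N : ℝ} (hN : 1 ≤ N) :
    {B : ℤ | (M ≤ B ∧ B ≤ M + N) ∧
        ∃ w : ℤ, 0 < w ∧ w ^ 4 + 18 * A * w ^ 2 + 108 * B * w = 27 * A ^ 2}.Finite ∧
      ({B : ℤ | (M ≤ B ∧ B ≤ M + N) ∧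
        ∃ w : ℤ, 0 < w ∧ w ^ 4 + 18 * A * w ^ 2 + 108 * B * w = 27 * A ^ 2}.ncard : ℝ) ≤
          6 * N ^ (1 / 3 : ℝ) := by
  set T : Set ℤ := {B : ℤ | (M ≤ B ∧ B ≤ M + N) ∧
    ∃ w : ℤ, 0 < w ∧ w ^ 4 + 18 * A * w ^ 2 + 108 * B * w = 27 * A ^ 2} with hT
  set t : ℝ := N ^ (1 / 3 : ℝ) with ht
  have ht1 : 1 ≤ t := Real.one_le_rpow hN (by norm_num)
  have ht3 : t ^ 3 = N := by
    rw [ht, ← Real.rpow_natCast, ← Real.rpow_mul (by linarith)]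
    norm_num
  choose! f hfpos hf using fun B (hB : B ∈ T) => hB.2
  have hinj : Set.InjOn f T := by
    intro B hB B' hB' hBB
    have h₁ := hf B hB
    have h₂ := hf B' hB'
    rw [← hBB] at h₂
    have h₃ : f B * (B - B') = 0 := by
      have : 108 * (f B * (B - B')) = 0 := by linear_combination h₁ - h₂
      simpa using this
    rcases mul_eq_zero.1 h₃ with h₄ | h₄
    · exact absurd h₄ (hfpos B hB).ne'
    · linarith
  have hdiam : ∀ u ∈ f '' T, ∀ v ∈ f '' T, (v : ℝ) - u ≤ 5 * t := by
    rintro _ ⟨B', hB', rfl⟩ _ ⟨B, hB, rfl⟩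
    rcases le_total (f B) (f B') with hle | hle
    · have : (f B : ℝ) ≤ f B' := by exact_mod_cast hle
      linarith
    · have hcube := cube_sub_le_of_division_roots (A := A) (B := B) (B' := B')
        (w := f B) (w' := f B') (by exact_mod_cast hfpos B' hB') (by exact_mod_cast hle)
        (by exact_mod_cast hf B hB) (by exact_mod_cast hf B' hB')
      -- The factor 5 works because `5 ^ 3 = 125 ≥ 108`.
      refine le_of_pow_le_pow_left₀ (n := 3) (by norm_num) (by positivity) (hcube.trans ?_)
      rw [mul_pow, ht3]
      linarith [hB.1.1, hB'.1.2]
  obtain ⟨hfin, hcard⟩ := Int.finite_and_ncard_le_of_sub_le (by positivity) hdiam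
  rw [hinj.ncard_image] at hcard
  exact ⟨hfin.of_finite_image hinj, by linarith⟩

/-- The quartic is invariant under `(B, w) ↦ (-B, -w)`, which reduces to `w > 0`; two signs of `w`
and two signs of `B` give `4 * 6 = 24`. -/
theorem finite_and_ncard_le_of_root {A : ℤ} (hA : A ≠ 0) (M : ℝ) {N : ℝ} (hN : 1 ≤ N) :
    {B : ℤ | (M ≤ |(B : ℝ)| ∧ |(B : ℝ)| ≤ M + N) ∧
        ∃ w : ℤ, w ^ 4 + 18 * A * w ^ 2 + 108 * B * w = 27 * A ^ 2}.Finite ∧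
      ({B : ℤ | (M ≤ |(B : ℝ)| ∧ |(B : ℝ)| ≤ M + N) ∧
        ∃ w : ℤ, w ^ 4 + 18 * A * w ^ 2 + 108 * B * w = 27 * A ^ 2}.ncard : ℝ) ≤
          24 * N ^ (1 / 3 : ℝ) := by
  let T (m : ℝ) : Set ℤ := {B : ℤ | (m ≤ B ∧ B ≤ m + N) ∧
    ∃ w : ℤ, 0 < w ∧ w ^ 4 + 18 * A * w ^ 2 + 108 * B * w = 27 * A ^ 2}
  have hT (m : ℝ) : (T m).Finite ∧ ((T m).ncard : ℝ) ≤ 6 * N ^ (1 / 3 : ℝ) :=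
    finite_and_ncard_le_of_pos_root A m hN
  have hnegT (m : ℝ) : (Neg.neg '' T m).Finite ∧
      ((Neg.neg '' T m).ncard : ℝ) ≤ 6 * N ^ (1 / 3 : ℝ) := by
    rw [Set.ncard_image_of_injective _ neg_injective]
    exact ⟨(hT m).1.image _, (hT m).2⟩
  set U : Set ℤ := (T M ∪ T (-M - N)) ∪ (Neg.neg '' T M ∪ Neg.neg '' T (-M - N)) with hU
  have hUfin : U.Finite :=
    ((hT _).1.union (hT _).1).union ((hnegT _).1.union (hnegT _).1)
  have hUcard : (U.ncard : ℝ) ≤ 24 * N ^ (1 / 3 : ℝ) := by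
    have h₁ : U.ncard ≤ ((T M).ncard + (T (-M - N)).ncard) +
        ((Neg.neg '' T M).ncard + (Neg.neg '' T (-M - N)).ncard) :=
      (Set.ncard_union_le _ _).trans
        (add_le_add (Set.ncard_union_le _ _) (Set.ncard_union_le _ _))
    have h₂ : (U.ncard : ℝ) ≤ ((T M).ncard + (T (-M - N)).ncard) +
        ((Neg.neg '' T M).ncard + (Neg.neg '' T (-M - N)).ncard) := by exact_mod_cast h₁
    linarith [(hT M).2, (hT (-M - N)).2, (hnegT M).2, (hnegT (-M - N)).2]
  have hmem (B w : ℤ) (hB : M ≤ |(B : ℝ)| ∧ |(B : ℝ)| ≤ M + N) (hw : 0 < w)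
      (h : w ^ 4 + 18 * A * w ^ 2 + 108 * B * w = 27 * A ^ 2) : B ∈ T M ∪ T (-M - N) := by
    rcases abs_choice (B : ℝ) with habs | habs <;> rw [habs] at hB
    · exact Or.inl ⟨hB, w, hw, h⟩
    · exact Or.inr ⟨⟨by linarith, by linarith⟩, w, hw, h⟩
  have hsub : {B : ℤ | (M ≤ |(B : ℝ)| ∧ |(B : ℝ)| ≤ M + N) ∧
      ∃ w : ℤ, w ^ 4 + 18 * A * w ^ 2 + 108 * B * w = 27 * A ^ 2} ⊆ U := by
    rintro B ⟨hB, w, h⟩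
    rcases lt_trichotomy w 0 with hw | rfl | hw
    · rw [hU, ← Set.image_union]
      refine Or.inr ⟨-B, hmem (-B) (-w) (by simpa using hB) (by omega) ?_, neg_neg B⟩
      linear_combination h
    -- A root `w = 0` would force `A = 0`.
    · simp [hA] at h
    · exact Or.inl (hmem B w hB hw h)
  refine ⟨hUfin.subset hsub, le_trans ?_ hUcard⟩
  exact_mod_cast Set.ncard_le_ncard hsub hUfin

/-! ### Counting in the box -/

theorem threeTorsionBox_ne_zero_finite_and_ncard_le (M₁ M₂ : ℝ) {N₁ N₂ : ℝ} (hN₁ : 1 ≤ N₁)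
    (hN₂ : 1 ≤ N₂) :
    {p ∈ threeTorsionBox M₁ N₁ M₂ N₂ | p.1 ≠ 0}.Finite ∧
      ({p ∈ threeTorsionBox M₁ N₁ M₂ N₂ | p.1 ≠ 0}.ncard : ℝ) ≤ 96 * (N₁ * N₂ ^ (1 / 3 : ℝ)) := by
  obtain ⟨hAfin, hAcard⟩ := Int.finite_and_ncard_le_of_abs_window M₁ (N := N₁) (by linarith)
  have hpos : 0 ≤ N₂ ^ (1 / 3 : ℝ) := Real.rpow_nonneg (by linarith) _
  obtain ⟨hfin, hcard⟩ := Set.finite_and_ncard_le_of_fst_fibers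
    (S := {p ∈ threeTorsionBox M₁ N₁ M₂ N₂ | p.1 ≠ 0}) hAfin (K := 24 * N₂ ^ (1 / 3 : ℝ))
    (fun p hp => hp.1.1) (fun A _ => by
      by_cases hA : A = 0
      · have hemp : {B : ℤ | (A, B) ∈ {p ∈ threeTorsionBox M₁ N₁ M₂ N₂ | p.1 ≠ 0}} = ∅ := by
          ext B
          simp [hA]
        rw [hemp]
        refine ⟨Set.finite_empty, ?_⟩
        simp only [Set.ncard_empty, Nat.cast_zero]
        positivity
      · obtain ⟨hf, hc⟩ := finite_and_ncard_le_of_root hA M₂ hN₂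
        have hsub : {B : ℤ | (A, B) ∈ {p ∈ threeTorsionBox M₁ N₁ M₂ N₂ | p.1 ≠ 0}} ⊆
            {B : ℤ | (M₂ ≤ |(B : ℝ)| ∧ |(B : ℝ)| ≤ M₂ + N₂) ∧
              ∃ w : ℤ, w ^ 4 + 18 * A * w ^ 2 + 108 * B * w = 27 * A ^ 2} :=
          fun B hB => ⟨hB.1.2.1, exists_int_root_of_rationalThreeTorsion_ne_bot hB.1.2.2.2⟩
        exact ⟨hf.subset hsub, le_trans (by exact_mod_cast Set.ncard_le_ncard hsub hf) hc⟩)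
  refine ⟨hfin, hcard.trans ?_⟩
  calc _ ≤ (2 * (N₁ + 1)) * (24 * N₂ ^ (1 / 3 : ℝ)) := by gcongr
    _ ≤ (4 * N₁) * (24 * N₂ ^ (1 / 3 : ℝ)) :=
      mul_le_mul_of_nonneg_right (by linarith) (by positivity)
    _ = _ := by ring

theorem threeTorsionBox_eq_zero_finite_and_ncard_le (M₁ N₁ M₂ : ℝ) {N₂ : ℝ} (hN₂ : 1 ≤ N₂) :
    {p ∈ threeTorsionBox M₁ N₁ M₂ N₂ | p.1 = 0}.Finite ∧
      ({p ∈ threeTorsionBox M₁ N₁ M₂ N₂ | p.1 = 0}.ncard : ℝ) ≤ 4 * N₂ := by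
  obtain ⟨hf, hc⟩ := Int.finite_and_ncard_le_of_abs_window M₂ (N := N₂) (by linarith)
  have hsub : {p ∈ threeTorsionBox M₁ N₁ M₂ N₂ | p.1 = 0} ⊆
      Prod.mk 0 '' {n : ℤ | M₂ ≤ |(n : ℝ)| ∧ |(n : ℝ)| ≤ M₂ + N₂} :=
    fun p hp => ⟨p.2, hp.1.2.1, Prod.ext hp.2.symm rfl⟩
  have hcard := Set.ncard_le_ncard hsub (hf.image _)
  rw [Set.ncard_image_of_injective _ (Prod.mk_right_injective 0)] at hcard
  have hcard' : ({p ∈ threeTorsionBox M₁ N₁ M₂ N₂ | p.1 = 0}.ncard : ℝ) ≤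
    ({n : ℤ | M₂ ≤ |(n : ℝ)| ∧ |(n : ℝ)| ≤ M₂ + N₂}.ncard : ℝ) := by exact_mod_cast hcard
  exact ⟨(hf.image _).subset hsub, by linarith⟩

theorem mainTheorem6 :
    ∃ C J₀ : ℝ, 0 < C ∧ 0 < J₀ ∧ ∀ J : ℝ, J₀ ≤ J →
      ((threeTorsionBox 0 (J ^ 2) 0 (J ^ 3)).Finite ∧
        ((threeTorsionBox 0 (J ^ 2) 0 (J ^ 3)).ncard : ℝ) ≤ C * J ^ 4) ∧
      ∀ b c : ℝ, 0 < b → b < 2 → 0 < c → c < 3 →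
        (threeTorsionBox (J ^ 2 - J ^ b) (J ^ b) (J ^ 3 - J ^ c) (J ^ c)).Finite ∧
        ((threeTorsionBox (J ^ 2 - J ^ b) (J ^ b) (J ^ 3 - J ^ c) (J ^ c)).ncard : ℝ) ≤
          C * J ^ (b + c - min b c / 2) := by
  -- `100 = 96 + 4` adds the bounds for `A ≠ 0` and `A = 0`; any `J₀ > 1` would do.
  refine ⟨100, 2, by norm_num, by norm_num, fun J hJ => ⟨?_, fun b c hb hb2 hc hc3 => ?_⟩⟩
  · have hJ0 : 0 ≤ J := by linarith
    have hJ1 : 1 ≤ J := by linarith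
    obtain ⟨hf₁, hc₁⟩ := threeTorsionBox_ne_zero_finite_and_ncard_le 0 0
      (one_le_pow₀ hJ1 : 1 ≤ J ^ 2) (one_le_pow₀ hJ1 : 1 ≤ J ^ 3)
    obtain ⟨hf₂, hc₂⟩ := threeTorsionBox_eq_zero_finite_and_ncard_le 0 (J ^ 2) 0
      (one_le_pow₀ hJ1 : 1 ≤ J ^ 3)
    have hunion : threeTorsionBox 0 (J ^ 2) 0 (J ^ 3) =
        {p ∈ threeTorsionBox 0 (J ^ 2) 0 (J ^ 3) | p.1 ≠ 0} ∪
          {p ∈ threeTorsionBox 0 (J ^ 2) 0 (J ^ 3) | p.1 = 0} := by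
      ext p
      simp only [Set.mem_union, Set.mem_ofPred_eq]
      tauto
    have hcube : (J ^ 3) ^ (1 / 3 : ℝ) = J := by
      rw [← Real.rpow_natCast, ← Real.rpow_mul hJ0]
      norm_num
    rw [hcube] at hc₁
    refine ⟨hunion ▸ hf₁.union hf₂, ?_⟩
    have hcard : ((threeTorsionBox 0 (J ^ 2) 0 (J ^ 3)).ncard : ℝ) ≤
        ({p ∈ threeTorsionBox 0 (J ^ 2) 0 (J ^ 3) | p.1 ≠ 0}.ncard : ℝ) +
          ({p ∈ threeTorsionBox 0 (J ^ 2) 0 (J ^ 3) | p.1 = 0}.ncard : ℝ) := by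
      conv_lhs => rw [hunion]
      exact_mod_cast Set.ncard_union_le _ _
    have hpow : J ^ 3 ≤ J ^ 4 := pow_le_pow_right₀ hJ1 (by norm_num)
    linarith [show J ^ 2 * J = J ^ 3 by ring]
  · have hJ1 : 1 < J := by linarith
    have hJ0 : 0 < J := by linarith
    obtain ⟨hf, hcard⟩ := threeTorsionBox_ne_zero_finite_and_ncard_le (J ^ 2 - J ^ b)
      (J ^ 3 - J ^ c) (Real.one_le_rpow hJ1.le hb.le) (Real.one_le_rpow hJ1.le hc.le)
    have hne : {p ∈ threeTorsionBox (J ^ 2 - J ^ b) (J ^ b) (J ^ 3 - J ^ c) (J ^ c) | p.1 ≠ 0} =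
        threeTorsionBox (J ^ 2 - J ^ b) (J ^ b) (J ^ 3 - J ^ c) (J ^ c) := by
      -- Since `b < 2`, the lower bound `J ^ 2 - J ^ b` on `|A|` is positive, which excludes `A =
      -- 0`.
      refine Set.sep_eq_self_iff_mem_true.2 fun p hp hp0 => ?_
      have hM := hp.1.1
      have hlt : J ^ b < J ^ 2 := by
        rw [← Real.rpow_natCast J 2]
        exact Real.rpow_lt_rpow_of_exponent_lt hJ1 (by exact_mod_cast hb2)
      rw [hp0, Int.cast_zero, abs_zero] at hM
      linarith
    rw [hne] at hf hcard
    refine ⟨hf, hcard.trans ?_⟩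
    rw [← Real.rpow_mul hJ0.le, ← Real.rpow_add hJ0]
    refine mul_le_mul (by norm_num) (Real.rpow_le_rpow_of_exponent_le hJ1.le ?_)
      (by positivity) (by norm_num)
    -- `b + c / 3 ≤ b + c / 2 ≤ b + c - min b c / 2`.
    linarith [min_le_right b c]
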